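/- Let $\ell^\infty$ be the Banach space of bounded real sequences, with its norm topology and the cylinder $\sigma$-algebra $\mathcal C$, i.e. the $\sigma$-algebra generated by all continuous linear functionals; write $(\ell^\infty)^*$ for the topological dual and $1\in\ell^\infty$ for the constant sequence. Let $C=\{0,1\}^{\mathbb N}\subset\ell^\infty$ be the Cantor space with its product $\sigma$-algebra and the Bernoulli product measure $\mu_0=\mathcal B(1/2)^{\otimes\mathbb N}$. (a) $(\ell^\infty,\|\cdot\|,\mathcal C)$ is a locally measurable vector space: it is a topological vector space, every point has a local basis of $\mathcal C$-measurable neighborhoods, and every continuous linear functional is $\mathcal C$-measurable. Moreover the addition $(\ell^\infty\times\ell^\infty,\mathcal C\otimes\mathcal C)\to(\ell^\infty,\mathcal C)$ is measurable, and $\mathcal C$ is invariant under $x\mapsto cx$ for every real $c\neq0$. (b) Suppose that there is a real-valued measurable cardinal $\kappa\le 2^{\aleph_0}$ (an uncountable cardinal $\kappa$ carrying a $\kappa$-additive probability measure, defined on all its subsets, that vanishes on singletons). Then there are a measure $\nu$ on all subsets of $C$ which extends $\mu_0$, and a probability measure $\tilde\mu$ on $(\ell^\infty,\mathcal C)$,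 given by $\tilde\mu(A)=\nu(A\cap C)$ for $A\in\mathcal C$, with the following properties. - Every measurable subset $A$ of $C$ belongs to $\mathcal C$, and $\tilde\mu(A)=\mu_0(A)$. - $\tilde\mu$ is symmetric: it is invariant under $x\mapsto 1-x$. - Sequences of i.i.d. random variables with law $\tilde\mu$ exist, and for every such sequence $(X_n)_{n\ge1}$, defined on any probability space, with empirical means $\overline X_n=(X_1+\dots+X_n)/n$, define $$s(x)=\inf_{V}\liminf_{n\to\infty}\frac1n\log\mathbb P(\overline X_n\in V),\qquad \overline s(x)=\inf_{V}\limsup_{n\to\infty}\frac1n\log\mathbb P(\overline X_n\in V),$$ where $V$ runs over the $\mathcal C$-measurable neighborhoods of $x \in \ell^\infty$ (and $\log 0=-\infty$), and $$p(f)=\limsup_{n\to\infty}\frac1n\log\mathbb E\bigl[e^{n f(\overline X_n)}\bigr]\quad(f\in(\ell^\infty)^*),\qquad p^*(x)=\sup_{f\in(\ell^\infty)^*}\bigl(f(x)-p(f)\bigr).$$ Then $s(x)=\overline s(x)=-\infty$ for every $x\in\ell^\infty$, while $p^*(\tfrac12\cdot 1)=0$; in particular $s\neq-p^*$. -/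

import Mathlib

open MeasureTheory ProbabilityTheory Filter Topology
open scoped ENNReal Cardinal Pointwise

/-- An uncountable cardinal `κ` is real-valued measurable if there is a `κ`-additive probability
measure, defined on all subsets of a set of cardinality `κ`, which vanishes on singletons. -/
def IsRealValuedMeasurable (κ : Cardinal.{0}) : Prop :=
  ℵ₀ < κ ∧ ∃ (S : Type) (_ : #S = κ) (m : @Measure S ⊤),
    m Set.univ = 1 ∧ (∀ a : S, m {a} = 0) ∧
    ∀ (ι : Type) (A : ι → Set S), #ι < κ → Pairwise (Function.onFun Disjoint A) →
      m (⋃ i, A i) = ∑' i, m (A i)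

section LocallyMeasurable

variable (X : Type*) [AddCommGroup X] [Module ℝ X] [TopologicalSpace X]

/-- The cylinder `σ`-algebra: the one generated by all the continuous linear functionals. -/
abbrev cylinderSigmaAlgebra : MeasurableSpace X :=
  ⨆ f : X →L[ℝ] ℝ, MeasurableSpace.comap f (borel ℝ)

/-- Locally measurable vector spaces: topological vector spaces with a `σ`-algebra such that
every point has a local basis of measurable neighborhoods and every continuous linear functional
is measurable. -/
structure IsLocallyMeasurableVectorSpace [MeasurableSpace X] : Prop where
  isTopologicalAddGroup : IsTopologicalAddGroup X
  continuousSMul : ContinuousSMul ℝ X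
  exists_measurable_nhds : ∀ x : X, ∀ U ∈ 𝓝 x, ∃ V ∈ 𝓝 x, MeasurableSet V ∧ V ⊆ U
  measurable_functional : ∀ f : X →L[ℝ] ℝ, Measurable f

/-- The `σ`-algebra of `X` is invariant under dilatations. -/
def IsDilatationInvariant [MeasurableSpace X] : Prop :=
  ∀ c : ℝ, c ≠ 0 → ∀ A : Set X, MeasurableSet A → MeasurableSet (c • A)

end LocallyMeasurable

noncomputable section LargeDeviations

variable {X Ω : Type*} [AddCommGroup X] [Module ℝ X] [TopologicalSpace X] [MeasurableSpace X]
  [MeasurableSpace Ω]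

/-- The entropy of `(Z n, v n)`; the infimum is over all measurable neighborhoods of `x`. -/
def ldEntropy (P : Measure Ω) (Z : ℕ → Ω → X) (v : ℕ → ℝ) (x : X) : EReal :=
  ⨅ V ∈ {V : Set X | V ∈ 𝓝 x ∧ MeasurableSet V},
    liminf (fun n => (((v n)⁻¹ : ℝ) : EReal) * ENNReal.log (P (Z n ⁻¹' V))) atTop

/-- The entropy superior of `(Z n, v n)`. -/
def ldEntropySup (P : Measure Ω) (Z : ℕ → Ω → X) (v : ℕ → ℝ) (x : X) : EReal :=
  ⨅ V ∈ {V : Set X | V ∈ 𝓝 x ∧ MeasurableSet V},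
    limsup (fun n => (((v n)⁻¹ : ℝ) : EReal) * ENNReal.log (P (Z n ⁻¹' V))) atTop

/-- The pressure of `(Z n, v n)`. -/
def ldPressure (P : Measure Ω) (Z : ℕ → Ω → X) (v : ℕ → ℝ) (f : X →L[ℝ] ℝ) : EReal :=
  limsup (fun n => (((v n)⁻¹ : ℝ) : EReal) *
    ENNReal.log (∫⁻ ω, ENNReal.ofReal (Real.exp (v n * f (Z n ω))) ∂P)) atTop

/-- The Fenchel-Legendre transform of a function on the topological dual. -/
def fenchelLegendre (h : (X →L[ℝ] ℝ) → EReal) (x : X) : EReal :=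
  ⨆ f : X →L[ℝ] ℝ, (((f x : ℝ) : EReal) - h f)

/-- The `n`-th empirical mean, `(Y 0 + ⋯ + Y (n - 1)) / n` (only `n ≥ 1` matters). -/
def empiricalMean (Y : ℕ → Ω → X) (n : ℕ) (ω : Ω) : X :=
  (n : ℝ)⁻¹ • ∑ i ∈ Finset.range n, Y i ω

/-- `Y 0, Y 1, …` are independent random variables with common law `μ`. -/
structure IsIIDWithLaw (P : Measure Ω) (Y : ℕ → Ω → X) (μ : Measure X) : Prop where
  measurable : ∀ i, Measurable (Y i)
  indep : iIndepFun Y P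
  law : ∀ i, P.map (Y i) = μ

end LargeDeviations

noncomputable section EllInfty

/-- The Banach space of bounded real sequences, with the supremum norm. -/
abbrev EllInfty : Type := lp (fun _ : ℕ => ℝ) ∞

instance EllInfty.instMeasurableSpace : MeasurableSpace EllInfty := cylinderSigmaAlgebra EllInfty

/-- The inclusion of the Cantor space `{0, 1}^ℕ` into `ℓ^∞`. -/
def cantorInclusion (c : ℕ → Bool) : EllInfty :=
  ⟨fun i => if c i then 1 else 0, memℓp_infty ⟨1, by
    rintro _ ⟨i, rfl⟩
    by_cases h : c i = true <;> simp [h]⟩⟩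

/-- The product of the Bernoulli measures of parameter `1/2` on the Cantor space. -/
def cantorMeasure : Measure (ℕ → Bool) :=
  Measure.infinitePi fun _ : ℕ => bernoulliMeasure true false ⟨1 / 2, by norm_num, by norm_num⟩

end EllInfty

/-! The cylinder σ-algebra sees every functional on `ℓ^∞`, including limits along free ultrafilters,
which are not measurable on the Cantor space for its product σ-algebra. A law on `ℓ^∞` carried by
the Cantor space is therefore obtained from a measure on all its subsets. A real-valued measurable
cardinal `κ ≤ 2^ℵ₀` gives an atomless law on `ℝ`; its distribution function makes it uniform, and
binary digits make it the coin-tossing law. Every map involved is defined on a space whose subsets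
are all measurable, so the image measure is total (`exists_total_extension`). Averaging with its
image under the flip makes it symmetric.

Entropy and pressure then disagree. For fixed `n`, each of the infinitely many independent
coordinates shows a prescribed letter in all `n` samples with probability `2^(-n)`, so almost surely
some coordinate does (`IsIIDWithLaw.measure_forall_exists_ne`). Prescribing at each coordinate the
letter far from `x` keeps the empirical mean out of a fixed ball around `x`: the entropy is `-∞`
everywhere. The pressure tests one functional at a time: it is the log-Laplace transform of the law,
and symmetry with Jensen's inequality gives `p f ≥ f (1/2)`, with equality at `f = 0`. -/

/-! ### Uniformization of an atomless law. -/

section UniformLaw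

/-- The cumulative distribution function of an atomless law is uniformly distributed. -/
lemma measure_cdf_lt (ρ : Measure ℝ) [IsProbabilityMeasure ρ] [NullSingletonClass ρ] {t : ℝ} (ht0 : 0 < t)
    (ht1 : t < 1) : ρ {x | cdf ρ x < t} = ENNReal.ofReal t := by
  have hcont : Continuous (cdf ρ) := by
    refine continuous_iff_continuousAt.2 fun x => ?_
    -- The jump of the distribution function at `x` is the mass of `{x}`, which is zero.
    have h := StieltjesFunction.measure_singleton (cdf ρ) x
    rw [measure_cdf, measure_singleton] at h
    have h1 : cdf ρ x ≤ Function.leftLim (cdf ρ) x := by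
      have := ENNReal.ofReal_eq_zero.1 h.symm
      linarith
    have h2 := (monotone_cdf ρ).leftLim_le (le_refl x)
    rw [(monotone_cdf ρ).continuousAt_iff_leftLim_eq_rightLim, StieltjesFunction.rightLim_eq]
    exact le_antisymm h2 h1
  obtain ⟨a, ha⟩ := mem_range_of_exists_le_of_exists_ge hcont
    (((tendsto_cdf_atBot ρ).eventually (gt_mem_nhds ht0)).exists.imp fun _ h => h.le)
    (((tendsto_cdf_atTop ρ).eventually (lt_mem_nhds ht1)).exists.imp fun _ h => h.le)
  have hbdd : BddBelow {x | t ≤ cdf ρ x} := by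
    obtain ⟨b, hb⟩ := ((tendsto_cdf_atBot ρ).eventually (gt_mem_nhds ht0)).exists
    refine ⟨b, fun x hx => ?_⟩
    by_contra! h
    exact absurd (monotone_cdf ρ h.le) (not_le.2 (lt_of_lt_of_le hb hx))
  have hne : {x | t ≤ cdf ρ x}.Nonempty := ⟨a, ha.ge⟩
  have hmem := (isClosed_le continuous_const hcont).csInf_mem hne hbdd
  -- By continuity `c` is the first point where the value `t` is reached, so the sublevel set is the
  -- half-line below `c`.
  set c := sInf {x | t ≤ cdf ρ x}
  have hc : cdf ρ c = t := le_antisymm (ha ▸ monotone_cdf ρ (csInf_le hbdd ha.ge)) hmem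
  have hset : {x | cdf ρ x < t} = Set.Iio c := by
    ext x
    refine ⟨fun hx => ?_, fun hx => ?_⟩
    · by_contra! h
      exact absurd (monotone_cdf ρ (not_lt.1 h)) (not_le.2 (hc ▸ hx))
    · by_contra h
      exact absurd (csInf_le hbdd (show t ≤ cdf ρ x from not_lt.1 h)) (not_le.2 hx)
  rw [hset, measure_congr Iio_ae_eq_Iic, ← ofReal_cdf, hc]

lemma map_cdf_Iio (ρ : Measure ℝ) [IsProbabilityMeasure ρ] [NullSingletonClass ρ] {t : ℝ} (ht0 : 0 ≤ t)
    (ht1 : t ≤ 1) : ρ.map (cdf ρ) (Set.Iio t) = ENNReal.ofReal t := by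
  rw [Measure.map_apply (monotone_cdf ρ).measurable measurableSet_Iio]
  rcases ht0.eq_or_lt with rfl | h0
  · have : cdf ρ ⁻¹' Set.Iio 0 = ∅ := by
      ext x; simpa using cdf_nonneg ρ x
    simp [this]
  rcases ht1.eq_or_lt with rfl | h1
  -- The value `1` need not be attained, so this endpoint is reached by letting `s` increase to `1`.
  · refine le_antisymm (by simpa using prob_le_one) ?_
    refine le_of_tendsto (x := 𝓝[<] (1 : ℝ)) (f := ENNReal.ofReal)
      (ENNReal.continuous_ofReal.continuousWithinAt) ?_
    filter_upwards [Ioo_mem_nhdsLT (zero_lt_one' ℝ)] with s hs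
    rw [← measure_cdf_lt ρ hs.1 hs.2]
    exact measure_mono fun x (hx : _ < _) => hx.trans hs.2
  · exact measure_cdf_lt ρ h0 h1

lemma map_cdf_Ico (ρ : Measure ℝ) [IsProbabilityMeasure ρ] [NullSingletonClass ρ] {a b : ℝ} (ha : 0 ≤ a)
    (hab : a ≤ b) (hb : b ≤ 1) : ρ.map (cdf ρ) (Set.Ico a b) = ENNReal.ofReal (b - a) := by
  have : IsProbabilityMeasure (ρ.map (cdf ρ)) :=
    Measure.isProbabilityMeasure_map (monotone_cdf ρ).measurable.aemeasurable
  have h : Set.Ico a b = Set.Iio b \ Set.Iio a := by ext; simp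
  rw [h, measure_sdiff (Set.Iio_subset_Iio hab) measurableSet_Iio.nullMeasurableSet
    (measure_ne_top _ _), map_cdf_Iio ρ (ha.trans hab) hb, map_cdf_Iio ρ ha (hab.trans hb),
    ENNReal.ofReal_sub _ ha]

end UniformLaw

/-! ### Coin tossing as binary digits of a uniform variable. -/

section BinaryDigits

/-- The sequence of binary digits of a real number in `[0, 1)`. -/
noncomputable def binaryDigits (u : ℝ) (i : ℕ) : Bool := decide (⌊2 ^ (i + 1) * u⌋₊ % 2 = 1)

/-- The integer whose first `n` binary digits are given. -/
def ofBinaryDigits (w : ℕ → Bool) : ℕ → ℕ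
  | 0 => 0
  | n + 1 => 2 * ofBinaryDigits w n + (w n).toNat

lemma ofBinaryDigits_lt (w : ℕ → Bool) (n : ℕ) : ofBinaryDigits w n < 2 ^ n := by
  induction n with
  | zero => simp [ofBinaryDigits]
  | succ n ih =>
    have := (w n).toNat_le
    rw [ofBinaryDigits, pow_succ]; omega

/-- Halving `⌊2 ^ (n + 1) * u⌋₊` gives `⌊2 ^ n * u⌋₊`, and the remainder is the next digit. -/
lemma binaryDigits_prefix_iff (w : ℕ → Bool) {u : ℝ} (h1 : u < 1) (n : ℕ) :
    (∀ i < n, binaryDigits u i = w i) ↔ ⌊2 ^ n * u⌋₊ = ofBinaryDigits w n := by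
  induction n with
  | zero => simpa [ofBinaryDigits] using h1
  | succ n ih =>
    have hdiv : ⌊2 ^ (n + 1) * u⌋₊ / 2 = ⌊2 ^ n * u⌋₊ := by
      rw [← Nat.floor_div_ofNat, pow_succ]
      congr 1
      field_simp
    rw [Nat.forall_lt_succ_right, ih, ofBinaryDigits, ← hdiv, binaryDigits]
    cases w n <;> simp <;> omega

lemma measurable_binaryDigits : Measurable binaryDigits := by
  refine measurable_pi_iff.2 fun i => ?_
  have h : Measurable fun u : ℝ => ⌊2 ^ (i + 1) * u⌋₊ :=
    Nat.measurable_floor.comp (measurable_const.mul measurable_id)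
  exact (measurable_from_top (f := fun k : ℕ => decide (k % 2 = 1))).comp h

/-- The uniform law on the two letters. -/
noncomputable def fairCoin : Measure Bool :=
  bernoulliMeasure true false ⟨1 / 2, by norm_num, by norm_num⟩

instance : IsProbabilityMeasure fairCoin := by
  unfold fairCoin; infer_instance

lemma fairCoin_singleton (b : Bool) : fairCoin {b} = 2⁻¹ := by
  have h (p : unitInterval) (hp : (p : ℝ) = 1 / 2) :
      (unitInterval.toNNReal p : ℝ≥0∞) = 2⁻¹ := by
    have : unitInterval.toNNReal p = 2⁻¹ := NNReal.eq (by simpa using hp)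
    rw [this, ENNReal.coe_inv two_ne_zero, ENNReal.coe_ofNat]
  rw [fairCoin, bernoulliMeasure_apply _ (MeasurableSet.singleton b)]
  cases b
  · simpa using h _ (by rw [unitInterval.coe_symm_eq]; norm_num)
  · simpa using h _ (one_div 2).symm

lemma cantorMeasure_eq : cantorMeasure = Measure.infinitePi fun _ : ℕ => fairCoin := rfl

instance : IsProbabilityMeasure cantorMeasure := by
  rw [cantorMeasure_eq]; infer_instance

/-- A law on sequences is determined by its prefixes, and a prefix is, up to a null set, a dyadic
interval of the right length. -/
lemma map_binaryDigits_eq_cantorMeasure {μ : Measure ℝ} [IsProbabilityMeasure μ]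
    (hμ : ∀ a b : ℝ, 0 ≤ a → a ≤ b → b ≤ 1 → μ (Set.Ico a b) = ENNReal.ofReal (b - a)) :
    μ.map binaryDigits = cantorMeasure := by
  have hP : IsProbabilityMeasure (μ.map binaryDigits) :=
    Measure.isProbabilityMeasure_map measurable_binaryDigits.aemeasurable
  refine ((Measure.isProjectiveLimit_infinitePi fun _ : ℕ => fairCoin).unique ?_).symm
  rw [isProjectiveLimit_nat_iff (isProjectiveMeasureFamily_pi fun _ : ℕ => fairCoin)]
  intro n
  refine Measure.ext_of_singleton fun w => ?_
  rw [Measure.pi_singleton, Measure.map_apply (by fun_prop) (MeasurableSet.singleton _),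
    Measure.map_apply measurable_binaryDigits (by measurability)]
  simp only [fairCoin_singleton]
  -- `Finset.Iic n` indexes `n + 1` letters, hence the exponents below; the letters of `v` beyond
  -- them play no role.
  set v : ℕ → Bool := fun i => if h : i ∈ Finset.Iic n then w ⟨i, h⟩ else false with hv
  have hfull : μ (Set.Ico 0 1)ᶜ = 0 := by
    rw [prob_compl_eq_zero_iff measurableSet_Ico, hμ 0 1 le_rfl zero_le_one le_rfl]; simp
  have hset : binaryDigits ⁻¹' (Preorder.frestrictLe n ⁻¹' {w}) =ᵐ[μ]
      Set.Ico (ofBinaryDigits v (n + 1) / 2 ^ (n + 1) : ℝ)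
        ((ofBinaryDigits v (n + 1) + 1) / 2 ^ (n + 1) : ℝ) := by
    have hae : ∀ᵐ u ∂μ, u ∈ Set.Ico (0 : ℝ) 1 := hfull
    filter_upwards [hae] with u hu
    refine propext ?_
    change Preorder.frestrictLe n (binaryDigits u) = w ↔ u ∈ Set.Ico _ _
    have h1 : Preorder.frestrictLe n (binaryDigits u) = w ↔
        ∀ i < n + 1, binaryDigits u i = v i := by
      rw [funext_iff]
      constructor
      · intro h i hi
        have := h ⟨i, Finset.mem_Iic.2 (by omega)⟩
        simp only [hv]
        rw [dif_pos (Finset.mem_Iic.2 (by omega))]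
        exact this
      · intro h i
        have := h i (by have := Finset.mem_Iic.1 i.2; omega)
        simp only [hv] at this
        rw [dif_pos i.2] at this
        exact this
    rw [h1, binaryDigits_prefix_iff v hu.2, Nat.floor_eq_iff (by have := hu.1; positivity),
      Set.mem_Ico, div_le_iff₀' (by positivity), lt_div_iff₀' (by positivity)]
  have hlt : (ofBinaryDigits v (n + 1) : ℝ) + 1 ≤ 2 ^ (n + 1) := by
    exact_mod_cast ofBinaryDigits_lt v (n + 1)
  rw [measure_congr hset, hμ _ _ (by positivity) (by gcongr; linarith)
    ((div_le_one (by positivity)).2 hlt), ← sub_div, add_sub_cancel_left]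
  simp [ENNReal.ofReal_inv_of_pos, ENNReal.ofReal_pow]
  rw [ENNReal.inv_pow]

end BinaryDigits

/-! ### Total extensions of the coin-tossing measure. -/

/-- A total extension of the Bernoulli product measure, from a real-valued measurable cardinal. -/
lemma exists_total_extension {κ : Cardinal.{0}} (hκ : IsRealValuedMeasurable κ)
    (hle : κ ≤ Cardinal.continuum) :
    ∃ ν : @Measure (ℕ → Bool) ⊤, ∀ A : Set (ℕ → Bool), MeasurableSet A → ν A = cantorMeasure A := by
  obtain ⟨-, S, rfl, m, hm1, hm0, -⟩ := hκ
  let _ : MeasurableSpace S := ⊤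
  rw [← Cardinal.mk_real] at hle
  obtain ⟨h⟩ := hle
  have hmeas : Measurable h := measurable_from_top
  have : IsProbabilityMeasure m := ⟨hm1⟩
  have : IsProbabilityMeasure (m.map h) := Measure.isProbabilityMeasure_map hmeas.aemeasurable
  have : NullSingletonClass (m.map h) := ⟨fun x => by
    rw [Measure.map_apply hmeas (MeasurableSet.singleton x)]
    rcases (Set.subsingleton_singleton.preimage h.injective).eq_empty_or_singleton
      with h0 | ⟨a, h0⟩
    · rw [h0, measure_empty]
    · rw [h0, hm0]⟩
  have hcdf := (monotone_cdf (m.map h)).measurable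
  have : IsProbabilityMeasure ((m.map h).map (cdf (m.map h))) :=
    Measure.isProbabilityMeasure_map hcdf.aemeasurable
  -- The σ-algebra of `S` is `⊤`, so the composite is measurable even into `⊤`.
  refine ⟨@Measure.map S (ℕ → Bool) ⊤ ⊤ (binaryDigits ∘ cdf (m.map h) ∘ h) m, fun A hA => ?_⟩
  rw [@Measure.map_apply S (ℕ → Bool) ⊤ ⊤ m _ (fun _ _ => trivial) A trivial,
    ← map_binaryDigits_eq_cantorMeasure (fun a b => map_cdf_Ico (m.map h)),
    Measure.map_apply measurable_binaryDigits hA,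
    Measure.map_apply hcdf (measurable_binaryDigits hA),
    Measure.map_apply hmeas (hcdf (measurable_binaryDigits hA))]
  rfl

/-- The exchange of the two letters. -/
def cantorFlip (c : ℕ → Bool) (i : ℕ) : Bool := !c i

lemma cantorFlip_cantorFlip (c : ℕ → Bool) : cantorFlip (cantorFlip c) = c := by
  ext; simp [cantorFlip]

lemma measurable_cantorFlip : Measurable cantorFlip :=
  measurable_pi_iff.2 fun i => measurable_from_top.comp (measurable_pi_apply i)

lemma map_cantorFlip : cantorMeasure.map cantorFlip = cantorMeasure := by
  rw [cantorMeasure_eq]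
  rw [show cantorFlip = fun c i => !(c i) from rfl]
  rw [Measure.infinitePi_map_pi _ (f := fun _ b => !b) (fun _ => measurable_from_top)]
  congr 1
  funext _
  refine Measure.ext_of_singleton fun b => ?_
  rw [Measure.map_apply measurable_from_top (MeasurableSet.singleton _),
    show (fun b => !b) ⁻¹' {b} = {!b} by ext x; cases x <;> cases b <;> simp,
    fairCoin_singleton, fairCoin_singleton]

/-- A symmetric total extension of the Bernoulli product measure. -/
lemma exists_symmetric_total_extension {κ : Cardinal.{0}} (hκ : IsRealValuedMeasurable κ)
    (hle : κ ≤ Cardinal.continuum) :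
    ∃ ν : @Measure (ℕ → Bool) ⊤,
      (∀ A : Set (ℕ → Bool), MeasurableSet A → ν A = cantorMeasure A) ∧
      ∀ A : Set (ℕ → Bool), ν (cantorFlip ⁻¹' A) = ν A := by
  obtain ⟨ν, hν⟩ := exists_total_extension hκ hle
  have hflip (A : Set (ℕ → Bool)) :
      @Measure.map _ _ ⊤ ⊤ cantorFlip ν A = ν (cantorFlip ⁻¹' A) :=
    @Measure.map_apply _ _ ⊤ ⊤ ν _ (fun _ _ => trivial) A trivial
  have happly (A : Set (ℕ → Bool)) :
      ((2⁻¹ : ℝ≥0∞) • (ν + @Measure.map _ _ ⊤ ⊤ cantorFlip ν)) A =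
        2⁻¹ * (ν A + ν (cantorFlip ⁻¹' A)) := by
    rw [Measure.smul_apply, Measure.add_apply, hflip, smul_eq_mul]
  refine ⟨(2⁻¹ : ℝ≥0∞) • (ν + @Measure.map _ _ ⊤ ⊤ cantorFlip ν), fun A hA => ?_, fun A => ?_⟩
  · rw [happly, hν A hA, hν _ (measurable_cantorFlip hA), ← Measure.map_apply measurable_cantorFlip hA,
      map_cantorFlip, ← two_mul, ← mul_assoc, ENNReal.inv_mul_cancel two_ne_zero ENNReal.ofNat_ne_top,
      one_mul]
  · have : cantorFlip ⁻¹' (cantorFlip ⁻¹' A) = A := by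
      ext c; simp [cantorFlip_cantorFlip]
    rw [happly, happly, this, add_comm]

/-! ### The cylinder σ-algebra of `ℓ^∞`. -/

section Cylinder

lemma measurable_cylinder_iff {α X : Type*} [MeasurableSpace α] [AddCommGroup X] [Module ℝ X]
    [TopologicalSpace X] {g : α → X} :
    @Measurable _ _ _ (cylinderSigmaAlgebra X) g ↔ ∀ f : X →L[ℝ] ℝ, Measurable fun a => f (g a) := by
  simp only [measurable_iff_comap_le, cylinderSigmaAlgebra, MeasurableSpace.comap_iSup,
    iSup_le_iff, MeasurableSpace.comap_comp]
  rfl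

lemma EllInfty.measurable_functional (f : EllInfty →L[ℝ] ℝ) : Measurable f :=
  measurable_cylinder_iff.1 measurable_id f

lemma EllInfty.measurable_apply (i : ℕ) : Measurable fun x : EllInfty => x i :=
  EllInfty.measurable_functional (lp.evalCLM ℝ (fun _ : ℕ => ℝ) ∞ i)

lemma EllInfty.measurable_add : Measurable fun z : EllInfty × EllInfty => z.1 + z.2 := by
  refine measurable_cylinder_iff.2 fun f => ?_
  simp only [map_add]
  exact ((EllInfty.measurable_functional f).comp measurable_fst).add
    ((EllInfty.measurable_functional f).comp measurable_snd)

lemma EllInfty.measurable_smul (c : ℝ) : Measurable fun x : EllInfty => c • x := by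
  refine measurable_cylinder_iff.2 fun f => ?_
  simp only [map_smul, smul_eq_mul]
  exact (EllInfty.measurable_functional f).const_mul c

lemma EllInfty.measurable_one_sub : Measurable fun x : EllInfty => 1 - x := by
  refine measurable_cylinder_iff.2 fun f => ?_
  simp only [map_sub]
  exact (EllInfty.measurable_functional f).const_sub (f 1)

/-- The supremum norm involves only countably many coordinates, each a continuous functional. -/
lemma EllInfty.measurableSet_closedBall (x : EllInfty) {r : ℝ} (hr : 0 ≤ r) :
    MeasurableSet (Metric.closedBall x r) := by
  have h : Metric.closedBall x r = ⋂ i, {y : EllInfty | |y i - x i| ≤ r} := by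
    ext y
    simp only [Metric.mem_closedBall, dist_eq_norm, Set.mem_iInter, Set.mem_ofPred_eq]
    refine ⟨fun h i => ?_, fun h => lp.norm_le_of_forall_le hr fun i => ?_⟩
    · exact (lp.norm_apply_le_norm ENNReal.top_ne_zero (y - x) i).trans h
    · exact h i
  rw [h]
  exact MeasurableSet.iInter fun i => measurableSet_le
    ((EllInfty.measurable_apply i).sub_const (x i)).abs measurable_const

lemma EllInfty.isLocallyMeasurableVectorSpace : IsLocallyMeasurableVectorSpace EllInfty where
  isTopologicalAddGroup := inferInstance
  continuousSMul := inferInstance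
  exists_measurable_nhds x U hU := by
    obtain ⟨r, hr, h⟩ := Metric.nhds_basis_closedBall.mem_iff.1 hU
    exact ⟨_, Metric.closedBall_mem_nhds x hr, EllInfty.measurableSet_closedBall x hr.le, h⟩
  measurable_functional := EllInfty.measurable_functional

lemma EllInfty.isDilatationInvariant : IsDilatationInvariant EllInfty := by
  intro c hc A hA
  rw [← Set.preimage_smul_inv₀ hc]
  exact EllInfty.measurable_smul c⁻¹ hA

end Cylinder

/-! ### The Cantor space as a measurable subset. -/

section Letters

/-- The coordinates of a bounded sequence that are equal to `1`. -/
noncomputable def EllInfty.letters (x : EllInfty) (i : ℕ) : Bool := decide (x i = 1)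

lemma cantorInclusion_apply (c : ℕ → Bool) (i : ℕ) :
    cantorInclusion c i = if c i then 1 else 0 := rfl

lemma EllInfty.letters_cantorInclusion (c : ℕ → Bool) :
    EllInfty.letters (cantorInclusion c) = c := by
  ext i
  simp [EllInfty.letters, cantorInclusion_apply]

/-- This left inverse of the inclusion uses evaluations only, so it pulls product-measurable sets
back to cylinder-measurable ones. -/
lemma EllInfty.measurable_letters : Measurable EllInfty.letters := by
  refine measurable_pi_iff.2 fun i => ?_
  refine measurable_to_bool ?_
  have : (fun x => EllInfty.letters x i) ⁻¹' {true} = {x | x i = 1} := by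
    ext; simp [EllInfty.letters]
  rw [this]
  exact EllInfty.measurable_apply i (MeasurableSet.singleton 1)

lemma measurableSet_range_cantorInclusion : MeasurableSet (Set.range cantorInclusion) := by
  have h : Set.range cantorInclusion = ⋂ i, {x : EllInfty | x i = 1 ∨ x i = 0} := by
    ext x
    simp only [Set.mem_range, Set.mem_iInter, Set.mem_ofPred_eq]
    constructor
    · rintro ⟨c, rfl⟩ i
      rw [cantorInclusion_apply]
      cases c i <;> simp
    · refine fun h => ⟨x.letters, ?_⟩
      ext i
      rw [cantorInclusion_apply, EllInfty.letters]
      rcases h i with h | h <;> simp [h]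
  rw [h]
  refine MeasurableSet.iInter fun i => ?_
  exact (EllInfty.measurable_apply i (MeasurableSet.singleton 1)).union
    (EllInfty.measurable_apply i (MeasurableSet.singleton 0))

lemma image_cantorInclusion (A : Set (ℕ → Bool)) :
    cantorInclusion '' A = Set.range cantorInclusion ∩ EllInfty.letters ⁻¹' A := by
  ext x
  constructor
  · rintro ⟨c, hc, rfl⟩
    exact ⟨⟨c, rfl⟩, by rwa [Set.mem_preimage, EllInfty.letters_cantorInclusion]⟩
  · rintro ⟨⟨c, rfl⟩, hc⟩
    rw [Set.mem_preimage, EllInfty.letters_cantorInclusion] at hc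
    exact ⟨c, hc, rfl⟩

lemma one_sub_cantorInclusion (c : ℕ → Bool) :
    1 - cantorInclusion c = cantorInclusion (cantorFlip c) := by
  ext i
  rw [lp.coeFn_sub, Pi.sub_apply, cantorInclusion_apply, cantorInclusion_apply, cantorFlip]
  cases c i <;> simp

end Letters

/-! ### The entropy is `-∞`. -/

section Entropy

variable {Ω : Type*} [MeasurableSpace Ω] {P : Measure Ω} {Y : ℕ → Ω → EllInfty}
  {μ : Measure EllInfty}

/-- For i.i.d. variables in the Cantor space, all the letters form a fair coin array. -/
lemma IsIIDWithLaw.map_letters [IsProbabilityMeasure P] (hY : IsIIDWithLaw P Y μ)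
    (hμ : μ.map EllInfty.letters = cantorMeasure) :
    P.map (fun ω i k => (Y k ω).letters i) =
      Measure.infinitePi fun _ : ℕ => Measure.infinitePi fun _ : ℕ => fairCoin := by
  have hm (k : ℕ) : Measurable fun ω => (Y k ω).letters :=
    EllInfty.measurable_letters.comp (hY.measurable k)
  have hm' (k i : ℕ) : Measurable fun ω => (Y k ω).letters i :=
    (measurable_pi_apply i).comp (hm k)
  have hlaw (k : ℕ) : P.map (fun ω => (Y k ω).letters) = cantorMeasure := by
    rw [← hμ, ← hY.law k, Measure.map_map EllInfty.measurable_letters (hY.measurable k)]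
    rfl
  have hlaw' (k i : ℕ) : P.map (fun ω => (Y k ω).letters i) = fairCoin := by
    have := Measure.infinitePi_map_eval (fun _ : ℕ => fairCoin) i
    rw [← cantorMeasure_eq, ← hlaw k, Measure.map_map (measurable_pi_apply i) (hm k)] at this
    exact this
  have h1 : iIndepFun (fun k ω i => (Y k ω).letters i) P :=
    hY.indep.comp _ fun _ => EllInfty.measurable_letters
  have h2 (k : ℕ) : iIndepFun (fun i ω => (Y k ω).letters i) P := by
    rw [iIndepFun_iff_map_fun_eq_infinitePi_map (hm' k)]
    simp only [hlaw']
    exact hlaw k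
  -- The swap makes the coordinate the outer index, so that independence is across coordinates, each
  -- carrying its whole sequence of samples.
  have h3 := (iIndepFun_uncurry' (X := fun k i ω => (Y k ω).letters i) hm' h1 h2).precomp
    (g := Prod.swap) Prod.swap_injective
  have h4 := h3.map_fun_eq_infinitePi_map fun p : ℕ × ℕ => hm' p.2 p.1
  simp only [hlaw'] at h4
  rw [← Measure.infinitePi_map_curry (fun _ _ : ℕ => fairCoin), ← h4,
    Measure.map_map (by fun_prop) (measurable_pi_iff.2 fun p : ℕ × ℕ => hm' p.2 p.1)]
  rfl

lemma infinitePi_exists_ne_lt_one (n : ℕ) (b : Bool) :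
    Measure.infinitePi (fun _ : ℕ => fairCoin) {z | ∃ k < n, z k ≠ b} < 1 := by
  have h : {z : ℕ → Bool | ∃ k < n, z k ≠ b} =
      (Set.pi (Finset.range n : Set ℕ) fun _ => {b})ᶜ := by
    ext z; simp [Set.mem_pi]
  have hpi : Measure.infinitePi (fun _ : ℕ => fairCoin)
      (Set.pi (Finset.range n : Set ℕ) fun _ => {b}) ≠ 0 := by
    rw [Measure.infinitePi_pi _ fun _ _ => MeasurableSet.singleton b]
    simp [fairCoin_singleton]
  rw [h, prob_compl_eq_one_sub (MeasurableSet.pi (Finset.countable_toSet _)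
    fun _ _ => MeasurableSet.singleton b)]
  exact ENNReal.sub_lt_self ENNReal.one_ne_top one_ne_zero hpi

/-- Almost surely, for any prescribed letters, some coordinate shows its letter `n` times. -/
lemma IsIIDWithLaw.measure_forall_exists_ne [IsProbabilityMeasure P] (hY : IsIIDWithLaw P Y μ)
    (hμ : μ.map EllInfty.letters = cantorMeasure) (b : ℕ → Bool) (n : ℕ) :
    P {ω | ∀ i, ∃ k < n, (Y k ω).letters i ≠ b i} = 0 := by
  have hm : Measurable fun ω i k => (Y k ω).letters i :=
    measurable_pi_iff.2 fun i => measurable_pi_iff.2 fun k => (measurable_pi_apply i).comp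
      (EllInfty.measurable_letters.comp (hY.measurable k))
  set ρ := Measure.infinitePi (fun _ : ℕ => fairCoin) with hρ
  set t : Bool → Set (ℕ → Bool) := fun b => {z | ∃ k < n, z k ≠ b} with ht
  have htm (b : Bool) : MeasurableSet (t b) := by
    simp only [ht, Set.ofPred_exists, ← exists_prop]
    refine MeasurableSet.iUnion fun k => MeasurableSet.iUnion fun _ => ?_
    exact (measurableSet_eq_fun (measurable_pi_apply k) measurable_const).compl
  -- The prescribed letter may vary with the coordinate; `r < 1` bounds the probability of missing
  -- it for both letters, so `m` coordinates cost at most `r ^ m`.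
  set r := max (ρ (t true)) (ρ (t false)) with hr
  have hr1 : r < 1 := max_lt (infinitePi_exists_ne_lt_one n true)
    (infinitePi_exists_ne_lt_one n false)
  refine le_antisymm (ge_of_tendsto' (ENNReal.tendsto_pow_atTop_nhds_zero_of_lt_one hr1)
    fun m => ?_) zero_le
  calc P {ω | ∀ i, ∃ k < n, (Y k ω).letters i ≠ b i}
      ≤ P ((fun ω i k => (Y k ω).letters i) ⁻¹'
          Set.pi (Finset.range m : Set ℕ) fun i => t (b i)) :=
        measure_mono fun ω hω i _ => hω i
    _ = ∏ i ∈ Finset.range m, ρ (t (b i)) := by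
        rw [← Measure.map_apply hm (MeasurableSet.pi (Finset.countable_toSet _)
          fun i _ => htm (b i)), hY.map_letters hμ,
          Measure.infinitePi_pi _ fun i _ => htm (b i)]
    _ ≤ ∏ _i ∈ Finset.range m, r := by
        refine Finset.prod_le_prod' fun i _ => ?_
        cases b i
        · exact le_max_right _ _
        · exact le_max_left _ _
    _ = r ^ m := by simp

lemma IsIIDWithLaw.measure_empiricalMean_closedBall [IsProbabilityMeasure P]
    (hY : IsIIDWithLaw P Y μ) (hμ : μ.map EllInfty.letters = cantorMeasure)
    (hrange : ∀ᵐ x ∂μ, x ∈ Set.range cantorInclusion) (x : EllInfty) {n : ℕ} (hn : n ≠ 0) :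
    P (empiricalMean Y n ⁻¹' Metric.closedBall x (1 / 4)) = 0 := by
  have hae : ∀ᵐ ω ∂P, ∀ k, Y k ω ∈ Set.range cantorInclusion := by
    refine ae_all_iff.2 fun k => ?_
    rw [← hY.law k] at hrange
    exact ae_of_ae_map (hY.measurable k).aemeasurable hrange
  -- The letter at distance at least `1/2` from `x i`, beyond the radius `1/4`.
  set b : ℕ → Bool := fun i => decide (x i < 1 / 2) with hb
  have hnull := hY.measure_forall_exists_ne hμ b n
  refine measure_mono_null_ae ?_ hnull
  filter_upwards [hae] with ω hω hball i
  by_contra! hcon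
  have hval : ∀ k < n, Y k ω i = if b i then 1 else 0 := by
    intro k hk
    obtain ⟨c, hc⟩ := hω k
    rw [← hcon k hk, ← hc, EllInfty.letters_cantorInclusion, cantorInclusion_apply]
  have hmean : empiricalMean Y n ω i = if b i then 1 else 0 := by
    have : empiricalMean Y n ω i = (n : ℝ)⁻¹ * ∑ k ∈ Finset.range n, Y k ω i := by
      rw [empiricalMean, lp.coeFn_smul, Pi.smul_apply, lp.coeFn_sum, Finset.sum_apply, smul_eq_mul]
    rw [this, Finset.sum_congr rfl fun k hk => hval k (Finset.mem_range.1 hk), Finset.sum_const,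
      Finset.card_range, nsmul_eq_mul, inv_mul_cancel_left₀ (by exact_mod_cast hn)]
  have hdist : |empiricalMean Y n ω i - x i| ≤ 1 / 4 :=
    (lp.norm_apply_le_norm ENNReal.top_ne_zero (empiricalMean Y n ω - x) i).trans
      (by rw [← dist_eq_norm]; exact hball)
  rw [hmean, abs_le] at hdist
  by_cases hx : x i < 1 / 2
  · rw [if_pos (decide_eq_true hx)] at hdist
    linarith
  · rw [if_neg (by simpa [hb] using hx)] at hdist
    linarith

lemma IsIIDWithLaw.eventuallyEq_bot [IsProbabilityMeasure P]
    (hY : IsIIDWithLaw P Y μ) (hμ : μ.map EllInfty.letters = cantorMeasure)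
    (hrange : ∀ᵐ x ∂μ, x ∈ Set.range cantorInclusion) (x : EllInfty) :
    (fun n : ℕ => ((((n : ℝ))⁻¹ : ℝ) : EReal) *
      ENNReal.log (P (empiricalMean Y n ⁻¹' Metric.closedBall x (1 / 4)))) =ᶠ[atTop]
      fun _ => ⊥ := by
  filter_upwards [eventually_ne_atTop 0] with n hn
  rw [hY.measure_empiricalMean_closedBall hμ hrange x hn, ENNReal.log_zero,
    EReal.coe_mul_bot_of_pos (by positivity)]

lemma IsIIDWithLaw.ldEntropySup_eq_bot [IsProbabilityMeasure P]
    (hY : IsIIDWithLaw P Y μ) (hμ : μ.map EllInfty.letters = cantorMeasure)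
    (hrange : ∀ᵐ x ∂μ, x ∈ Set.range cantorInclusion) (x : EllInfty) :
    ldEntropySup P (empiricalMean Y) (fun n => n) x = ⊥ := by
  refine le_bot_iff.1 (iInf₂_le_of_le (Metric.closedBall x (1 / 4))
    ⟨Metric.closedBall_mem_nhds x (by norm_num),
      EllInfty.measurableSet_closedBall x (by norm_num)⟩ ?_)
  rw [limsup_congr (hY.eventuallyEq_bot hμ hrange x), limsup_const]

lemma IsIIDWithLaw.ldEntropy_eq_bot [IsProbabilityMeasure P]
    (hY : IsIIDWithLaw P Y μ) (hμ : μ.map EllInfty.letters = cantorMeasure)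
    (hrange : ∀ᵐ x ∂μ, x ∈ Set.range cantorInclusion) (x : EllInfty) :
    ldEntropy P (empiricalMean Y) (fun n => n) x = ⊥ := by
  refine le_bot_iff.1 (iInf₂_le_of_le (Metric.closedBall x (1 / 4))
    ⟨Metric.closedBall_mem_nhds x (by norm_num),
      EllInfty.measurableSet_closedBall x (by norm_num)⟩ ?_)
  rw [liminf_congr (hY.eventuallyEq_bot hμ hrange x), liminf_const]

end Entropy

/-! ### The pressure and its transform at the center of symmetry. -/

section Pressure

variable {Ω : Type*} [MeasurableSpace Ω] {P : Measure Ω} {Y : ℕ → Ω → EllInfty}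
  {μ : Measure EllInfty}

/-- Independence turns the exponential moment into an `n`-th power, so the sequence is constant for
`n ≥ 1`. -/
lemma IsIIDWithLaw.ldPressure_eq (hY : IsIIDWithLaw P Y μ) (f : EllInfty →L[ℝ] ℝ) :
    ldPressure P (empiricalMean Y) (fun n => n) f =
      ENNReal.log (∫⁻ x, ENNReal.ofReal (Real.exp (f x)) ∂μ) := by
  have hg : Measurable fun x => ENNReal.ofReal (Real.exp (f x)) :=
    (EllInfty.measurable_functional f).exp.ennreal_ofReal
  have h : (fun n : ℕ => ((((n : ℝ))⁻¹ : ℝ) : EReal) * ENNReal.log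
      (∫⁻ ω, ENNReal.ofReal (Real.exp (n * f (empiricalMean Y n ω))) ∂P)) =ᶠ[atTop]
      fun _ => ENNReal.log (∫⁻ x, ENNReal.ofReal (Real.exp (f x)) ∂μ) := by
    filter_upwards [eventually_ne_atTop 0] with n hn
    have hn' : (n : ℝ) ≠ 0 := by exact_mod_cast hn
    have hexp (ω : Ω) : ENNReal.ofReal (Real.exp (n * f (empiricalMean Y n ω))) =
        ∏ k ∈ Finset.range n, ENNReal.ofReal (Real.exp (f (Y k ω))) := by
      rw [empiricalMean, map_smul, smul_eq_mul, mul_inv_cancel_left₀ hn', map_sum, Real.exp_sum,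
        ENNReal.ofReal_prod_of_nonneg fun _ _ => (Real.exp_pos _).le]
    simp only [hexp]
    rw [lintegral_prod_eq_prod_lintegral_of_indepFun (Finset.range n)
      (fun k ω => ENNReal.ofReal (Real.exp (f (Y k ω)))) (hY.indep.comp _ fun _ => hg)
      fun k => hg.comp (hY.measurable k)]
    have hk (k : ℕ) : ∫⁻ ω, ENNReal.ofReal (Real.exp (f (Y k ω))) ∂P =
        ∫⁻ x, ENNReal.ofReal (Real.exp (f x)) ∂μ := by
      rw [← hY.law k, lintegral_map hg (hY.measurable k)]
    simp only [hk, Finset.prod_const, Finset.card_range]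
    rw [ENNReal.log_pow, ← mul_assoc, ← EReal.coe_natCast, ← EReal.coe_mul, inv_mul_cancel₀ hn',
      EReal.coe_one, one_mul]
  exact (limsup_congr h).trans (limsup_const _)

/-- Arithmetic-geometric mean inequality, to be applied to the values of a functional at `x` and `1
- x`, whose sum does not depend on `x`. -/
lemma two_mul_exp_half_le (a c : ℝ) :
    2 * Real.exp (c / 2) ≤ Real.exp a + Real.exp (c - a) := by
  have h1 : Real.exp (c / 2) = Real.exp (a / 2) * Real.exp ((c - a) / 2) := by
    rw [← Real.exp_add]; ring_nf
  have h2 : Real.exp a = Real.exp (a / 2) ^ 2 := by rw [← Real.exp_nat_mul]; ring_nf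
  have h3 : Real.exp (c - a) = Real.exp ((c - a) / 2) ^ 2 := by
    rw [← Real.exp_nat_mul]; ring_nf
  rw [h1, h2, h3]
  nlinarith [sq_nonneg (Real.exp (a / 2) - Real.exp ((c - a) / 2))]

/-- Jensen's inequality for the exponential of a functional, under a symmetric law. -/
lemma ofReal_exp_half_le_lintegral [IsProbabilityMeasure μ]
    (hsymm : μ.map (fun x => 1 - x) = μ) (f : EllInfty →L[ℝ] ℝ) :
    ENNReal.ofReal (Real.exp (f ((1 / 2 : ℝ) • (1 : EllInfty)))) ≤
      ∫⁻ x, ENNReal.ofReal (Real.exp (f x)) ∂μ := by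
  have hg : Measurable fun x => ENNReal.ofReal (Real.exp (f x)) :=
    (EllInfty.measurable_functional f).exp.ennreal_ofReal
  have hflip : ∫⁻ x, ENNReal.ofReal (Real.exp (f x)) ∂μ =
      ∫⁻ x, ENNReal.ofReal (Real.exp (f (1 - x))) ∂μ := by
    conv_lhs => rw [← hsymm]
    rw [lintegral_map hg EllInfty.measurable_one_sub]
  have hadd : 2 * ∫⁻ x, ENNReal.ofReal (Real.exp (f x)) ∂μ =
      ∫⁻ x, ENNReal.ofReal (Real.exp (f x)) + ENNReal.ofReal (Real.exp (f (1 - x))) ∂μ := by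
    rw [lintegral_add_left hg, ← hflip, two_mul]
  rw [← ENNReal.mul_le_mul_iff_right two_ne_zero ENNReal.ofNat_ne_top, hadd]
  calc 2 * ENNReal.ofReal (Real.exp (f ((1 / 2 : ℝ) • (1 : EllInfty))))
      = ∫⁻ _, 2 * ENNReal.ofReal (Real.exp (f ((1 / 2 : ℝ) • (1 : EllInfty)))) ∂μ := by simp
    _ ≤ _ := lintegral_mono fun x => by
        rw [← ENNReal.ofReal_add (Real.exp_pos _).le (Real.exp_pos _).le,
          ← ENNReal.ofReal_ofNat 2, ← ENNReal.ofReal_mul zero_le_two]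
        refine ENNReal.ofReal_le_ofReal ?_
        have := two_mul_exp_half_le (f x) (f 1)
        rw [map_smul, map_sub, smul_eq_mul]
        convert this using 3
        ring

lemma IsIIDWithLaw.fenchelLegendre_ldPressure_half (hY : IsIIDWithLaw P Y μ)
    [IsProbabilityMeasure μ] (hsymm : μ.map (fun x => 1 - x) = μ) :
    fenchelLegendre (ldPressure P (empiricalMean Y) (fun n => n))
      ((1 / 2 : ℝ) • (1 : EllInfty)) = 0 := by
  -- Symmetry makes every term nonpositive, and the term of `f = 0` vanishes because the law has
  -- mass one.
  refine le_antisymm (iSup_le fun f => ?_) (le_iSup_of_le 0 ?_)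
  · rw [hY.ldPressure_eq]
    refine EReal.sub_nonpos.2 ?_
    rw [← Real.log_exp (f _), ← ENNReal.log_ofReal_of_pos (Real.exp_pos _)]
    exact ENNReal.log_le_log (ofReal_exp_half_le_lintegral hsymm f)
  · rw [hY.ldPressure_eq]
    simp

end Pressure

/-! ### Existence of samples and conclusion. -/

/-- The i.i.d. sequence of coordinates on the infinite product. -/
lemma isIIDWithLaw_eval (μ : Measure EllInfty) [IsProbabilityMeasure μ] :
    IsIIDWithLaw (Measure.infinitePi fun _ : ℕ => μ) (fun i ω => ω i) μ where
  measurable := measurable_pi_apply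
  indep := iIndepFun_infinitePi (X := fun _ x => x) fun _ => measurable_id
  law := Measure.infinitePi_map_eval _

theorem mainTheorem7 :
    (IsLocallyMeasurableVectorSpace EllInfty ∧
      Measurable (fun z : EllInfty × EllInfty => z.1 + z.2) ∧
      IsDilatationInvariant EllInfty) ∧
    ((∃ κ : Cardinal.{0}, IsRealValuedMeasurable κ ∧ κ ≤ Cardinal.continuum) →
      ∃ (ν : @Measure (ℕ → Bool) ⊤) (μ : Measure EllInfty),
        -- `ν` extends the Bernoulli product measure to all subsets of the Cantor space
        (∀ A : Set (ℕ → Bool), MeasurableSet A → ν A = cantorMeasure A) ∧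
        -- `μ` is `ν`, seen on the cylinder `σ`-algebra of `ℓ^∞`
        (∀ A : Set EllInfty, MeasurableSet A → μ A = ν (cantorInclusion ⁻¹' A)) ∧
        IsProbabilityMeasure μ ∧
        (∀ A : Set (ℕ → Bool), MeasurableSet A →
          MeasurableSet (cantorInclusion '' A) ∧ μ (cantorInclusion '' A) = cantorMeasure A) ∧
        μ.map (fun x => 1 - x) = μ ∧
        (∃ (Ω : Type) (_ : MeasurableSpace Ω) (P : Measure Ω) (Y : ℕ → Ω → EllInfty),
          IsProbabilityMeasure P ∧ IsIIDWithLaw P Y μ) ∧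
        ∀ (Ω : Type*) [MeasurableSpace Ω] (P : Measure Ω) [IsProbabilityMeasure P]
          (Y : ℕ → Ω → EllInfty), IsIIDWithLaw P Y μ →
          (∀ x, ldEntropy P (empiricalMean Y) (fun n => n) x = ⊥) ∧
          (∀ x, ldEntropySup P (empiricalMean Y) (fun n => n) x = ⊥) ∧
          fenchelLegendre (ldPressure P (empiricalMean Y) (fun n => n))
            ((1 / 2 : ℝ) • (1 : EllInfty)) = 0 ∧
          ldEntropy P (empiricalMean Y) (fun n => n) ≠
            fun x => -fenchelLegendre (ldPressure P (empiricalMean Y) (fun n => n)) x) := by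
  refine ⟨⟨EllInfty.isLocallyMeasurableVectorSpace, EllInfty.measurable_add,
    EllInfty.isDilatationInvariant⟩, ?_⟩
  rintro ⟨κ, hκ, hle⟩
  obtain ⟨ν, hν, hflip⟩ := exists_symmetric_total_extension hκ hle
  -- Totality of `ν` is essential here: the inclusion is measurable from `⊤` to the cylinder
  -- σ-algebra.
  let μ : Measure EllInfty := @Measure.map _ _ ⊤ _ cantorInclusion ν
  have hμ (A : Set EllInfty) (hA : MeasurableSet A) : μ A = ν (cantorInclusion ⁻¹' A) :=
    @Measure.map_apply _ _ ⊤ _ ν _ (fun _ _ => trivial) A hA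
  have hletters (A : Set (ℕ → Bool)) :
      cantorInclusion ⁻¹' (EllInfty.letters ⁻¹' A) = A := by
    ext c; simp [EllInfty.letters_cantorInclusion]
  have hprob : IsProbabilityMeasure μ := ⟨by
    rw [hμ _ MeasurableSet.univ, Set.preimage_univ, hν _ MeasurableSet.univ, measure_univ]⟩
  have himage (A : Set (ℕ → Bool)) (hA : MeasurableSet A) :
      MeasurableSet (cantorInclusion '' A) ∧ μ (cantorInclusion '' A) = cantorMeasure A := by
    have hm : MeasurableSet (cantorInclusion '' A) := by
      rw [image_cantorInclusion]
      exact measurableSet_range_cantorInclusion.inter (EllInfty.measurable_letters hA)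
    refine ⟨hm, ?_⟩
    rw [hμ _ hm, image_cantorInclusion, Set.preimage_inter, hletters, Set.preimage_range,
      Set.univ_inter, hν A hA]
  have hsymm : μ.map (fun x => 1 - x) = μ := by
    ext A hA
    rw [Measure.map_apply EllInfty.measurable_one_sub hA, hμ _ (EllInfty.measurable_one_sub hA),
      hμ A hA, ← hflip (cantorInclusion ⁻¹' A)]
    congr 1
    ext c
    simp only [Set.mem_preimage, one_sub_cantorInclusion]
  have hlaw : μ.map EllInfty.letters = cantorMeasure := by
    ext A hA
    rw [Measure.map_apply EllInfty.measurable_letters hA, hμ _ (EllInfty.measurable_letters hA),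
      hletters, hν A hA]
  have hrange : ∀ᵐ x ∂μ, x ∈ Set.range cantorInclusion := by
    change Set.range cantorInclusion ∈ ae μ
    rw [mem_ae_iff_prob_eq_one measurableSet_range_cantorInclusion, ← Set.image_univ,
      (himage _ MeasurableSet.univ).2, measure_univ]
  refine ⟨ν, μ, hν, hμ, hprob, himage, hsymm, ⟨ℕ → EllInfty, inferInstance,
    Measure.infinitePi fun _ => μ, fun i ω => ω i, inferInstance, isIIDWithLaw_eval μ⟩, ?_⟩
  intro Ω _ P _ Y hY
  have hstar := hY.fenchelLegendre_ldPressure_half hsymm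
  refine ⟨hY.ldEntropy_eq_bot hlaw hrange, hY.ldEntropySup_eq_bot hlaw hrange, hstar, fun h => ?_⟩
  -- At the center the equality would read `-∞ = 0`.
  have h' := congrFun h ((1 / 2 : ℝ) • (1 : EllInfty))
  rw [hY.ldEntropy_eq_bot hlaw hrange, hstar] at h'
  simp at h'
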